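/- For $s_1,\dots,s_r\in\mathbb{N}$ with $s_1>1$ let $$\zeta^\star(s_1,\dots,s_r)=\sum_{k_1\ge\cdots\ge k_r\ge 1}\frac{1}{k_1^{s_1}\cdots k_r^{s_r}}$$ be the (convergent) multiple zeta star value, let $\{a_1,\dots,a_k\}^d$ denote $d$ successive repetitions of the sequence $a_1,\dots,a_k$, and let $B_n$ be the Bernoulli numbers. Then for all positive integers $m$ and $d$, $$\zeta^\star\bigl(\{\{2\}^{m-1},3,\{2\}^{m-1},1\}^d\bigr)=\pi^{4md}\sum_{\substack{k_1,\dots,k_d\ge 0\\ k_1+3k_2+\cdots+(2d-1)k_d=2d}}\ \prod_{j=1}^{d}\frac{1}{k_j!}\left(\frac{(2-2^{2m(2j-1)})\,B_{2m(2j-1)}}{(2j-1)\,(2m(2j-1))!}\right)^{k_j}$$ and $$\zeta^\star\bigl(\{\{2\}^{m-1},3,\{2\}^{m-1},1\}^d,\{2\}^m\bigr)=(-1)^m\,\pi^{2m(2d+1)}\sum_{\substack{k_1,\dots,k_{d+1}\ge 0\\ k_1+3k_2+\cdots+(2d+1)k_{d+1}=2d+1}}\ \prod_{j=1}^{d+1}\frac{1}{k_j!}\left(\frac{(2-2^{2m(2j-1)})\,B_{2m(2j-1)}}{(2j-1)\,(2m(2j-1))!}\right)^{k_j}.$$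 Here the sums run over non-negative integers $k_j$ satisfying the displayed linear condition. -/

import Mathlib

/-- The index set of a multiple zeta star series of depth `r`:
the tuples `k₁ ≥ k₂ ≥ ⋯ ≥ k_r ≥ 1` of natural numbers. -/
abbrev StarTuple (r : ℕ) : Type :=
  {k : Fin r → ℕ // Antitone k ∧ ∀ i, 1 ≤ k i}

/-- The summand `1 / (k₁ ^ s₁ ⋯ k_r ^ s_r)` of the multiple zeta star series of `s`. -/
noncomputable def zetaStarTerm (s : List ℕ) (k : StarTuple s.length) : ℝ :=
  ∏ i : Fin s.length, 1 / (k.1 i : ℝ) ^ s.get i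

/-- The multiple zeta star value `ζ⋆(s₁, …, s_r)`. -/
noncomputable def zetaStar (s : List ℕ) : ℝ :=
  ∑' k : StarTuple s.length, zetaStarTerm s k

/-- The multi-index `{2}^{m-1}, 3, {2}^{m-1}, 1` (used for `m ≥ 1`). -/
def block (m : ℕ) : List ℕ :=
  List.replicate (m - 1) 2 ++ [3] ++ List.replicate (m - 1) 2 ++ [1]

/-- The multi-index `{{2}^{m-1}, 3, {2}^{m-1}, 1}^d`. -/
def blocks (m d : ℕ) : List ℕ :=
  (List.replicate d (block m)).flatten

/-- The tuples `(k₁, …, k_r)` of natural numbers with `k₁ + 3 k₂ + ⋯ + (2r-1) k_r = n`; the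
coordinate `j : Fin r` is `k_{j+1}`. The bound `k_j ≤ n` is automatic, see `mem_oddTuples`. -/
def oddTuples (r n : ℕ) : Finset (Fin r → ℕ) :=
  (Fintype.piFinset fun _ : Fin r => Finset.range (n + 1)).filter
    fun k => ∑ j : Fin r, (2 * (j : ℕ) + 1) * k j = n

theorem mem_oddTuples {r n : ℕ} {k : Fin r → ℕ} :
    k ∈ oddTuples r n ↔ ∑ j : Fin r, (2 * (j : ℕ) + 1) * k j = n := by
  simp only [oddTuples, Finset.mem_filter, Fintype.mem_piFinset, Finset.mem_range,
    and_iff_right_iff_imp]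
  intro h j
  have h1 := Finset.single_le_sum (f := fun j : Fin r => (2 * (j : ℕ) + 1) * k j)
    (fun _ _ => Nat.zero_le _) (Finset.mem_univ j)
  simp only [h] at h1
  nlinarith [Nat.zero_le ((j : ℕ) * k j)]

/-- The rational number `(2 - 2 ^ {2mq}) B_{2mq} / (q · (2mq)!)`. -/
noncomputable def bernoulliFactor (m q : ℕ) : ℚ :=
  (2 - 2 ^ (2 * m * q)) * bernoulli (2 * m * q) / ((q : ℚ) * (Nat.factorial (2 * m * q) : ℚ))

/-- The sum over `k₁ + 3 k₂ + ⋯ + (2r-1) k_r = n` of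
`∏_{j=1}^r (1 / k_j!) ((2 - 2 ^ {2m(2j-1)}) B_{2m(2j-1)} / ((2j-1) (2m(2j-1))!)) ^ {k_j}`. -/
noncomputable def bellSum (m r n : ℕ) : ℚ :=
  ∑ k ∈ oddTuples r n, ∏ j : Fin r,
    1 / (Nat.factorial (k j) : ℚ) * bernoulliFactor m (2 * (j : ℕ) + 1) ^ k j

/-! Every truncated star sum in play is `∑ₖ K(n,k+1) f(k)`, with `K(n,k) = n!²/((n-k)!(n+k)!)`, and
prepending an entry to the multi-index acts on `f` alone (`KernelRep.two`, `.one`, `.three`). With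
`v k = (-1)^k/(k+1)^(2m)`, a whole block is `f ↦ v · sumOp (v · sumOp f)` (`KernelRep.block`), so `d
≥ 1` blocks give `f = 2 v · starCoeff v j`, with `j = 2d-1`, or `j = 2d` when `{2}^m` is appended.
As `n → ∞` the kernel tends to 1, and the value is `∑ₖ 2 v k * starCoeff v j k`, the coefficient of
`x^(j+1)` in `∏ₖ (1 + v k x)/(1 - v k x) = exp (∑_{q odd} (2/q) p_q x^q)`, where `p_q = ∑ₖ (v k)^q`.
Each `p_q` is an alternating zeta value at `2mq`, hence a Bernoulli number times a power of `π`;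
expanding the exponential gives the sum over `oddTuples`. -/

open Finset

/-! ### The kernel and its recurrences -/

/-- The kernel `n!² / ((n - k)! (n + k)!)`, which vanishes for `k > n`. -/
noncomputable def starKernel (n k : ℕ) : ℝ :=
  ∏ i ∈ range k, ((n : ℝ) - i) / ((n : ℝ) + i + 1)

theorem starKernel_zero_right (n : ℕ) : starKernel n 0 = 1 := by
  simp [starKernel]

theorem starKernel_succ_right (n k : ℕ) :
    ((n : ℝ) + k + 1) * starKernel n (k + 1) = ((n : ℝ) - k) * starKernel n k := by
  have h : (n : ℝ) + k + 1 ≠ 0 := by positivity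
  rw [starKernel, prod_range_succ, ← starKernel]
  field_simp

theorem starKernel_eq_zero {n k : ℕ} (h : n < k) : starKernel n k = 0 :=
  prod_eq_zero (mem_range.2 h) (by simp)

theorem starKernel_nonneg (n k : ℕ) : 0 ≤ starKernel n k := by
  rcases lt_or_ge n k with h | h
  · rw [starKernel_eq_zero h]
  · refine prod_nonneg fun i hi => div_nonneg ?_ (by positivity)
    have : (i : ℝ) ≤ n := by exact_mod_cast (mem_range.1 hi).le.trans h
    linarith

theorem starKernel_le_one (n k : ℕ) : starKernel n k ≤ 1 := by
  rcases lt_or_ge n k with h | h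
  · rw [starKernel_eq_zero h]; exact zero_le_one
  · refine prod_le_one (fun i hi => div_nonneg ?_ (by positivity)) fun i hi => ?_
    · have : (i : ℝ) ≤ n := by exact_mod_cast (mem_range.1 hi).le.trans h
      linarith
    · rw [div_le_one (by positivity)]
      have : (0 : ℝ) ≤ i := by positivity
      linarith

/-- The division-free form also covers `k = n + 1`, where both sides vanish. -/
theorem starKernel_succ_left (n k : ℕ) :
    (((n : ℝ) + 1) ^ 2 - (k : ℝ) ^ 2) * starKernel (n + 1) k =
      ((n : ℝ) + 1) ^ 2 * starKernel n k := by
  induction k with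
  | zero => simp [starKernel_zero_right]
  | succ k ih =>
    have h1 := starKernel_succ_right (n + 1) k
    have h2 := starKernel_succ_right n k
    have h : (n : ℝ) + k + 1 ≠ 0 := by positivity
    push_cast at h1 ⊢
    apply mul_left_cancel₀ h
    linear_combination ((n : ℝ) + k + 1) * ((n : ℝ) - k) * h1 - ((n : ℝ) + 1) ^ 2 * h2 +
      ((n : ℝ) - k) * ih

theorem tendsto_starKernel (k : ℕ) :
    Filter.Tendsto (fun n => starKernel n k) Filter.atTop (nhds 1) := by
  have h : ∀ i ∈ range k, Filter.Tendsto
      (fun n : ℕ => ((n : ℝ) - i) / ((n : ℝ) + i + 1)) Filter.atTop (nhds 1) := by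
    intro i _
    have h1 : Filter.Tendsto (fun n : ℕ => 1 - (2 * i + 1 : ℝ) / ((n : ℝ) + (i + 1)))
        Filter.atTop (nhds (1 - 0)) :=
      tendsto_const_nhds.sub (tendsto_const_nhds.div_atTop
        (Filter.tendsto_atTop_add_const_right _ _ tendsto_natCast_atTop_atTop))
    rw [sub_zero] at h1
    refine h1.congr fun n => ?_
    have : (n : ℝ) + i + 1 ≠ 0 := by positivity
    have : (n : ℝ) + (i + 1) ≠ 0 := by positivity
    field_simp
    ring
  simpa [starKernel] using tendsto_finsetProd (range k) h

/-! ### The operator `sumOp` -/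

/-- The summation operator `u ↦ (L ↦ u_L + 2 ∑_{k < L} u_k)`. -/
def sumOp (u : ℕ → ℝ) (L : ℕ) : ℝ :=
  u L + 2 * ∑ k ∈ range L, u k

theorem sum_alternating_sumOp (u : ℕ → ℝ) (L : ℕ) :
    ∑ k ∈ range (L + 1), (-1) ^ k * sumOp u k = (-1) ^ L * ∑ k ∈ range (L + 1), u k := by
  induction L with
  | zero => simp [sumOp]
  | succ L ih =>
    rw [sum_range_succ, ih, sumOp, sum_range_succ u (L + 1)]
    ring

/-- Up to signs `sumOp` is its own inverse. This supplies the preimage needed for an entry 3 and is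
the source of the alternating signs. -/
theorem sumOp_alternating_sumOp (u : ℕ → ℝ) (L : ℕ) :
    sumOp (fun k => (-1) ^ k * sumOp u k) L = (-1) ^ L * u L := by
  cases L with
  | zero => simp [sumOp]
  | succ L =>
    rw [sumOp, sum_alternating_sumOp, sumOp]
    ring

theorem sumOp_alternating_const (c : ℝ) (L : ℕ) :
    sumOp (fun k => (-1) ^ k * c) L = c := by
  have h (L : ℕ) : ∑ k ∈ range L, (-1 : ℝ) ^ k * c = (1 - (-1) ^ L) / 2 * c := by
    induction L with
    | zero => simp
    | succ L ih => rw [sum_range_succ, ih]; ring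
  rw [sumOp, h]
  ring

/-! ### Operations on kernel expansions -/

/-- Expansion of a sequence in the kernel. -/
noncomputable def kernelSum (f : ℕ → ℝ) (n : ℕ) : ℝ :=
  ∑ k ∈ range n, starKernel n (k + 1) * f k

/-- Telescopes: by `starKernel_succ_right`, each summand is the difference of two consecutive values
of the right side, which is 0 at `j = n`. -/
theorem sum_starKernel_tail (n j : ℕ) :
    ∀ i, j + i = n → ∑ k ∈ Ico j n, 2 * ((k : ℝ) + 1) * starKernel n (k + 1) =
      ((n : ℝ) + j + 1) * starKernel n (j + 1) := by
  intro i
  induction i generalizing j with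
  | zero =>
    rintro rfl
    simp [starKernel_eq_zero]
  | succ i ih =>
    intro h
    rw [sum_eq_sum_Ico_succ_bot (by omega), ih (j + 1) (by omega)]
    have := starKernel_succ_right n (j + 1)
    push_cast at this ⊢
    linear_combination this

theorem natCast_mul_starKernel (n j : ℕ) (h : j < n) :
    (n : ℝ) * starKernel n (j + 1) = ((j : ℝ) + 1) * starKernel n (j + 1) +
      ∑ k ∈ Ico (j + 1) n, 2 * ((k : ℝ) + 1) * starKernel n (k + 1) := by
  rw [sum_starKernel_tail n (j + 1) (n - (j + 1)) (by omega)]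
  have := starKernel_succ_right n (j + 1)
  push_cast at this ⊢
  linear_combination -this

theorem natCast_mul_kernelSum (f : ℕ → ℝ) (n : ℕ) :
    (n : ℝ) * kernelSum f n = kernelSum (fun k => ((k : ℝ) + 1) * sumOp f k) n := by
  have h1 : (n : ℝ) * kernelSum f n = ∑ j ∈ range n, (((j : ℝ) + 1) * starKernel n (j + 1) * f j +
      ∑ k ∈ Ico (j + 1) n, 2 * ((k : ℝ) + 1) * starKernel n (k + 1) * f j) := by
    rw [kernelSum, mul_sum]
    refine sum_congr rfl fun j hj => ?_
    rw [← sum_mul, ← add_mul, ← natCast_mul_starKernel n j (mem_range.1 hj), mul_assoc]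
  have h2 : ∑ j ∈ range n, ∑ k ∈ Ico (j + 1) n, 2 * ((k : ℝ) + 1) * starKernel n (k + 1) * f j =
      ∑ k ∈ range n, ∑ j ∈ range k, 2 * ((k : ℝ) + 1) * starKernel n (k + 1) * f j := by
    refine sum_comm' fun x y => ?_
    simp only [mem_range, mem_Ico]
    omega
  rw [h1, sum_add_distrib, h2, ← sum_add_distrib, kernelSum]
  refine sum_congr rfl fun k _ => ?_
  rw [← mul_sum, sumOp]
  ring

/-- The partial sums telescope, and the boundary term dies once `L` reaches the upper index. At
upper index 0 the sum is empty, so `KernelRep` only asks about `n + 1`. -/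
theorem kernelSum_alternating_two (n : ℕ) :
    kernelSum (fun k => (-1) ^ k * 2) (n + 1) = 1 := by
  have h (N L : ℕ) : (N : ℝ) * ∑ k ∈ range L, starKernel N (k + 1) * ((-1) ^ k * 2) =
      N - (-1) ^ L * ((N + L + 1) * starKernel N (L + 1)) := by
    induction L with
    | zero =>
      have := starKernel_succ_right N 0
      rw [starKernel_zero_right] at this
      push_cast at this ⊢
      simp only [range_zero, sum_empty]
      linear_combination this
    | succ L ih =>
      rw [sum_range_succ, mul_add, ih]
      have := starKernel_succ_right N (L + 1)
      push_cast at this ⊢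
      linear_combination (-1) ^ (L + 1) * this
  have h1 := h (n + 1) (n + 1)
  rw [starKernel_eq_zero (Nat.lt_succ_self _), mul_zero, mul_zero, sub_zero] at h1
  have h2 : ((n + 1 : ℕ) : ℝ) ≠ 0 := by positivity
  rw [kernelSum]
  exact mul_left_cancel₀ h2 (by rw [h1, mul_one])

theorem kernelSum_succ_sub (f : ℕ → ℝ) (n : ℕ) :
    ((n : ℝ) + 1) ^ 2 * (kernelSum f (n + 1) - kernelSum f n) =
      kernelSum (fun k => ((k : ℝ) + 1) ^ 2 * f k) (n + 1) := by
  have h : kernelSum f n = ∑ k ∈ range (n + 1), starKernel n (k + 1) * f k := by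
    rw [sum_range_succ, starKernel_eq_zero (Nat.lt_succ_self _), zero_mul, add_zero, kernelSum]
  rw [h, kernelSum, ← sum_sub_distrib, mul_sum, kernelSum]
  refine sum_congr rfl fun k _ => ?_
  have := starKernel_succ_left n (k + 1)
  push_cast at this
  linear_combination f k * this

/-! ### Star sums through the kernel -/

/-- The truncated multiple harmonic star sum, with largest index at most `n`. -/
noncomputable def harmonicStar : List ℕ → ℕ → ℝ
  | [], _ => 1
  | s :: l, n => ∑ j ∈ range n, 1 / ((j : ℝ) + 1) ^ s * harmonicStar l (j + 1)

/-- The sequence `f` represents the star sums of `l` through the kernel. -/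
def KernelRep (l : List ℕ) (f : ℕ → ℝ) : Prop :=
  ∀ n, harmonicStar l (n + 1) = kernelSum f (n + 1)

/-- By `kernelSum_succ_sub`, `hg` says that both sides have the same increments in `n`; both start
at 0. -/
theorem KernelRep.cons {l : List ℕ} {f g : ℕ → ℝ} {s : ℕ} (h : KernelRep l f)
    (hg : ∀ n : ℕ, ((n : ℝ) + 1) ^ 2 * kernelSum f (n + 1) =
      ((n : ℝ) + 1) ^ s * kernelSum (fun k => ((k : ℝ) + 1) ^ 2 * g k) (n + 1)) :
    KernelRep (s :: l) g := by
  have key : ∀ n, harmonicStar (s :: l) n = kernelSum g n := by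
    intro n
    induction n with
    | zero => simp [harmonicStar, kernelSum]
    | succ n ih =>
      rw [harmonicStar] at ih ⊢
      rw [sum_range_succ, ih, h n]
      have h1 := hg n
      rw [← kernelSum_succ_sub] at h1
      have h2 : ((n : ℝ) + 1) ≠ 0 := by positivity
      have h3 : ((n : ℝ) + 1) ^ s ≠ 0 := by positivity
      have h4 : ((n : ℝ) + 1) ^ 2 ≠ 0 := by positivity
      have h5 : kernelSum f (n + 1) =
          ((n : ℝ) + 1) ^ s * (kernelSum g (n + 1) - kernelSum g n) :=
        mul_left_cancel₀ h4 (by linear_combination h1)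
      rw [h5]
      field_simp
      ring
  exact fun n => key (n + 1)

theorem KernelRep.two {l : List ℕ} {f : ℕ → ℝ} (h : KernelRep l f) :
    KernelRep (2 :: l) (fun k => f k / ((k : ℝ) + 1) ^ 2) := by
  refine h.cons fun n => ?_
  congr 2
  funext k
  have : (k : ℝ) + 1 ≠ 0 := by positivity
  field_simp

theorem KernelRep.replicate_two {l : List ℕ} {f : ℕ → ℝ} (h : KernelRep l f) (i : ℕ) :
    KernelRep (List.replicate i 2 ++ l) (fun k => f k / ((k : ℝ) + 1) ^ (2 * i)) := by
  induction i with
  | zero => simpa using h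
  | succ i ih =>
    have h1 := ih.two
    rw [List.replicate_succ, List.cons_append]
    convert h1 using 2 with k
    rw [div_div, ← pow_add]
    congr 1

theorem KernelRep.one {l : List ℕ} {f : ℕ → ℝ} (h : KernelRep l f) :
    KernelRep (1 :: l) (fun k => sumOp f k / ((k : ℝ) + 1)) := by
  refine h.cons fun n => ?_
  have h1 := natCast_mul_kernelSum f (n + 1)
  push_cast at h1
  rw [pow_two, mul_assoc, h1, pow_one]
  congr 2
  funext k
  have : (k : ℝ) + 1 ≠ 0 := by positivity
  field_simp

/-- An entry 3 is an entry 2 with an extra division by `n`, so `f` must be pulled back along `g ↦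
(k+1) · sumOp g`, which is multiplication by `n`. -/
theorem KernelRep.three {l : List ℕ} {f g : ℕ → ℝ} (h : KernelRep l f)
    (hg : ∀ k : ℕ, ((k : ℝ) + 1) * sumOp g k = f k) :
    KernelRep (3 :: l) (fun k => g k / ((k : ℝ) + 1) ^ 2) := by
  refine h.cons fun n => ?_
  have h1 := natCast_mul_kernelSum g (n + 1)
  simp only [hg] at h1
  have h2 : kernelSum (fun k => ((k : ℝ) + 1) ^ 2 * (g k / ((k : ℝ) + 1) ^ 2)) (n + 1) =
      kernelSum g (n + 1) := by
    congr 1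
    funext k
    have : (k : ℝ) + 1 ≠ 0 := by positivity
    field_simp
  rw [h2, ← h1]
  push_cast
  ring

/-- The signed weights `(-1)^k / (k + 1)^{2m}`. -/
noncomputable def altWeight (m k : ℕ) : ℝ :=
  (-1) ^ k / ((k : ℝ) + 1) ^ (2 * m)

theorem KernelRep.block {l : List ℕ} {f : ℕ → ℝ} (h : KernelRep l f) {m : ℕ} (hm : 0 < m) :
    KernelRep (block m ++ l) (fun k => altWeight m k *
      sumOp (fun k => altWeight m k * sumOp f k) k) := by
  obtain ⟨i, rfl⟩ : ∃ i, m = i + 1 := ⟨m - 1, by omega⟩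
  have h1 := h.one.replicate_two i
  -- The entry 1 and the twos leave `sumOp f / (k+1)^(2i+1)`; dividing by `k+1` completes the
  -- exponent to `2m`, and inverting `sumOp` inserts a sign on each side.
  have h2 := (h1.three (g := fun k => (-1) ^ k *
    sumOp (fun k => altWeight (i + 1) k * sumOp f k) k) (fun k => by
      rw [sumOp_alternating_sumOp, altWeight]
      have : (k : ℝ) + 1 ≠ 0 := by positivity
      have h2 : ((-1 : ℝ) ^ k) * (-1) ^ k = 1 := by
        rw [← mul_pow]; simp
      field_simp
      linear_combination (((k : ℝ) + 1) ^ (2 * (i + 1))) * sumOp f k * h2)).replicate_two i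
  have e : _root_.block (i + 1) ++ l =
      List.replicate i 2 ++ 3 :: (List.replicate i 2 ++ 1 :: l) := by
    simp [_root_.block]
  rw [e]
  convert h2 using 2 with k
  rw [altWeight]
  have : (k : ℝ) + 1 ≠ 0 := by positivity
  field_simp
  ring

/-- The `j`-th iterate of `u ↦ sumOp (v * u)`, applied to the constant sequence `1`. -/
noncomputable def starCoeff (v : ℕ → ℝ) : ℕ → ℕ → ℝ
  | 0 => fun _ => 1
  | j + 1 => sumOp fun k => v k * starCoeff v j k

theorem kernelRep_nil : KernelRep [] fun k => (-1) ^ k * 2 :=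
  fun n => (kernelSum_alternating_two n).symm

theorem sumOp_const_mul (c : ℝ) (u : ℕ → ℝ) (L : ℕ) :
    sumOp (fun k => c * u k) L = c * sumOp u L := by
  simp only [sumOp, ← mul_sum]
  ring

theorem blocks_succ (m d : ℕ) : blocks m (d + 1) = block m ++ blocks m d := by
  simp [blocks, List.replicate_succ]

theorem KernelRep.blocks {l : List ℕ} {f : ℕ → ℝ} {m i : ℕ} (h : KernelRep l f) (hm : 0 < m)
    (hf : sumOp f = fun L => 2 * starCoeff (altWeight m) i L) (d : ℕ) :
    KernelRep (blocks m (d + 1) ++ l) (fun k => 2 * (altWeight m k *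
      starCoeff (altWeight m) (i + 2 * d + 1) k)) := by
  have step : ∀ {l : List ℕ} {f : ℕ → ℝ} {i : ℕ}, KernelRep l f →
      (sumOp f = fun L => 2 * starCoeff (altWeight m) i L) →
      KernelRep (_root_.block m ++ l)
        (fun k => 2 * (altWeight m k * starCoeff (altWeight m) (i + 1) k)) := by
    intro l f i h hf
    convert h.block hm using 2 with k
    rw [hf]
    have : (fun k => altWeight m k * (fun L => 2 * starCoeff (altWeight m) i L) k) =
        fun k => 2 * (altWeight m k * starCoeff (altWeight m) i k) := by
      funext k; ring
    rw [this, sumOp_const_mul, starCoeff]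
    ring
  induction d with
  | zero =>
    rw [blocks_succ, List.append_assoc]
    exact step h hf
  | succ d ih =>
    rw [blocks_succ, List.append_assoc]
    exact step ih (funext fun L => sumOp_const_mul _ _ _)

theorem kernelRep_blocks {m : ℕ} (hm : 0 < m) (d : ℕ) :
    KernelRep (blocks m (d + 1)) (fun k => 2 * (altWeight m k *
      starCoeff (altWeight m) (2 * d + 1) k)) := by
  have := kernelRep_nil.blocks (i := 0) hm
    (by funext L; rw [sumOp_alternating_const, starCoeff, mul_one]) d
  simpa using this

/-- The trailing twos turn `2(-1)^k` into `2 * altWeight m k`, so the iteration starts one `sumOp`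
later and the parity of the index changes. -/
theorem kernelRep_blocks_append {m : ℕ} (hm : 0 < m) (d : ℕ) :
    KernelRep (blocks m (d + 1) ++ List.replicate m 2) (fun k => 2 * (altWeight m k *
      starCoeff (altWeight m) (2 * d + 2) k)) := by
  have h := kernelRep_nil.replicate_two m
  rw [List.append_nil] at h
  have := h.blocks (i := 1) hm (by
    funext L
    rw [starCoeff, ← sumOp_const_mul]
    congr 1
    funext k
    rw [starCoeff, altWeight]
    ring) d
  rwa [show 1 + 2 * d + 1 = 2 * d + 2 by ring] at this

/-! ### From truncated sums to the infinite series -/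

theorem hasSum_of_tendsto_sum_monotone {ι : Type*} {f : ι → ℝ} (hf : ∀ i, 0 ≤ f i)
    {T : ℕ → Finset ι} (hT : Monotone T) (hcov : ∀ i, ∃ n, i ∈ T n) {a : ℝ}
    (h : Filter.Tendsto (fun n => ∑ i ∈ T n, f i) Filter.atTop (nhds a)) : HasSum f a := by
  have hT' : Filter.Tendsto T Filter.atTop Filter.atTop :=
    Filter.tendsto_atTop_finset_of_monotone hT hcov
  have hmono : Monotone fun n => ∑ i ∈ T n, f i := fun _ _ hab =>
    sum_le_sum_of_subset_of_nonneg (hT hab) fun i _ _ => hf i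
  have hs : Summable f := by
    refine summable_of_sum_le (c := a) hf fun u => ?_
    obtain ⟨n, hn⟩ := (hT'.eventually (Filter.eventually_ge_atTop u)).exists
    exact (sum_le_sum_of_subset_of_nonneg hn fun i _ _ => hf i).trans (hmono.ge_of_tendsto h n)
  have := tendsto_nhds_unique (hs.hasSum.comp hT') h
  exact this ▸ hs.hasSum

/-- The antitone tuples with entries in `[1, n]`. -/
def boundedTuples (r n : ℕ) : Finset (Fin r → ℕ) :=
  {k ∈ Fintype.piFinset fun _ : Fin r => Icc 1 n | ∀ i j, i ≤ j → k j ≤ k i}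

theorem mem_boundedTuples {r n : ℕ} {k : Fin r → ℕ} :
    k ∈ boundedTuples r n ↔ (∀ i, 1 ≤ k i ∧ k i ≤ n) ∧ ∀ i j, i ≤ j → k j ≤ k i := by
  simp [boundedTuples]

theorem sum_boundedTuples_succ {r : ℕ} (n : ℕ) (F : (Fin (r + 1) → ℕ) → ℝ) :
    ∑ k ∈ boundedTuples (r + 1) n, F k =
      ∑ j ∈ range n, ∑ k ∈ boundedTuples r (j + 1), F (Fin.cons (j + 1) k) := by
  rw [sum_sigma']
  symm
  refine sum_bij' (fun p _ => Fin.cons (p.1 + 1) p.2)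
    (fun k _ => ⟨k 0 - 1, Fin.tail k⟩) ?_ ?_ ?_ ?_ ?_
  · rintro ⟨j, k⟩ hp
    simp only [mem_sigma, mem_range, mem_boundedTuples] at hp
    obtain ⟨hj, hk, hanti⟩ := hp
    rw [mem_boundedTuples]
    constructor
    · intro i
      refine Fin.cases ?_ (fun i => ?_) i
      · simp only [Fin.cons_zero]; omega
      · simp only [Fin.cons_succ]; have := hk i; omega
    · intro i i'
      refine Fin.cases ?_ (fun i => ?_) i <;> refine Fin.cases ?_ (fun i' => ?_) i'
      · simp
      · intro _; simpa using (hk i').2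
      · intro h; simp at h
      · intro h; simpa using hanti i i' (by simpa using h)
  · intro k hk
    rw [mem_boundedTuples] at hk
    have h0 := hk.1 0
    simp only [mem_sigma, mem_range, mem_boundedTuples, Fin.tail]
    refine ⟨by omega, fun i => ⟨(hk.1 _).1, ?_⟩, fun i j hij => hk.2 _ _ (by simpa using hij)⟩
    have := hk.2 0 i.succ (Fin.zero_le _)
    omega
  · rintro ⟨j, k⟩ hp
    simp
  · intro k hk
    rw [mem_boundedTuples] at hk
    have h0 := hk.1 0
    have : k 0 - 1 + 1 = k 0 := by omega
    simp [this]
  · intros; rfl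

theorem sum_boundedTuples_eq_harmonicStar (s : List ℕ) (n : ℕ) :
    ∑ k ∈ boundedTuples s.length n, ∏ i : Fin s.length, 1 / (k i : ℝ) ^ s.get i =
      harmonicStar s n := by
  induction s generalizing n with
  | nil =>
    have : boundedTuples ([] : List ℕ).length n = {Fin.elim0} := by
      ext k
      simp only [mem_boundedTuples, mem_singleton]
      exact ⟨fun _ => funext fun i => i.elim0, fun _ => ⟨fun i => i.elim0, fun i => i.elim0⟩⟩
    rw [this, sum_singleton, harmonicStar]
    rfl
  | cons a l ih =>
    rw [harmonicStar]
    refine (sum_boundedTuples_succ (r := l.length) n _).trans ?_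
    refine sum_congr rfl fun j _ => ?_
    rw [← ih, mul_sum]
    refine sum_congr rfl fun k _ => ?_
    refine (Fin.prod_univ_succ (n := l.length) _).trans ?_
    simp

theorem zetaStarTerm_nonneg (s : List ℕ) (k : StarTuple s.length) : 0 ≤ zetaStarTerm s k :=
  prod_nonneg fun _ _ => by positivity

theorem hasSum_zetaStarTerm {s : List ℕ} {a : ℝ}
    (h : Filter.Tendsto (harmonicStar s) Filter.atTop (nhds a)) :
    HasSum (zetaStarTerm s) a := by
  classical
  refine hasSum_of_tendsto_sum_monotone (zetaStarTerm_nonneg s)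
    (T := fun n => (boundedTuples s.length n).subtype _) ?_ ?_ ?_
  · intro n n' hn k hk
    rw [mem_subtype, mem_boundedTuples] at hk ⊢
    exact ⟨fun i => ⟨(hk.1 i).1, (hk.1 i).2.trans hn⟩, hk.2⟩
  · intro k
    refine ⟨∑ i, k.1 i, ?_⟩
    rw [mem_subtype, mem_boundedTuples]
    exact ⟨fun i => ⟨k.2.2 i, single_le_sum (f := k.1) (fun _ _ => Nat.zero_le _) (mem_univ i)⟩,
      fun i j hij => k.2.1 hij⟩
  · refine h.congr fun n => ?_
    rw [← sum_boundedTuples_eq_harmonicStar]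
    refine (sum_subtype_of_mem (fun k : Fin s.length → ℕ => ∏ i, 1 / (k i : ℝ) ^ s.get i)
      fun k hk => ?_).symm
    rw [mem_boundedTuples] at hk
    exact ⟨fun i j hij => hk.2 i j hij, fun i => (hk.1 i).1⟩

/-- Dominated convergence: the kernel lies in `[0, 1]` and tends to 1 pointwise. -/
theorem tendsto_kernelSum {f : ℕ → ℝ} (hf : Summable f) :
    Filter.Tendsto (kernelSum f) Filter.atTop (nhds (∑' k, f k)) := by
  have h : ∀ n, kernelSum f n = ∑' k, starKernel n (k + 1) * f k := fun n => by
    rw [tsum_eq_sum (s := range n) fun k hk => ?_]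
    · rfl
    · rw [starKernel_eq_zero (by simpa [Nat.lt_succ_iff] using hk), zero_mul]
  refine Filter.Tendsto.congr (fun n => (h n).symm) ?_
  refine tendsto_tsum_of_dominated_convergence hf.abs (fun k => ?_)
    (Filter.Eventually.of_forall fun n k => ?_)
  · simpa using (tendsto_starKernel (k + 1)).mul_const (f k)
  · rw [norm_mul, Real.norm_of_nonneg (starKernel_nonneg _ _), Real.norm_eq_abs]
    exact mul_le_of_le_one_left (abs_nonneg _) (starKernel_le_one _ _)

theorem KernelRep.hasSum {s : List ℕ} {f : ℕ → ℝ} (h : KernelRep s f) (hf : Summable f) :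
    HasSum (zetaStarTerm s) (∑' k, f k) := by
  refine hasSum_zetaStarTerm ((Filter.tendsto_add_atTop_iff_nat 1).1 ?_)
  exact ((tendsto_kernelSum hf).comp (Filter.tendsto_add_atTop_nat 1)).congr fun n => (h n).symm

theorem exists_abs_starCoeff_le {v : ℕ → ℝ} (hv : Summable v) (j : ℕ) :
    ∃ C, ∀ k, |starCoeff v j k| ≤ C := by
  induction j with
  | zero => exact ⟨1, fun k => by simp [starCoeff]⟩
  | succ j ih =>
    obtain ⟨C, hC⟩ := ih
    have hC0 : 0 ≤ C := (abs_nonneg _).trans (hC 0)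
    refine ⟨2 * ((∑' k, |v k|) * C), fun L => ?_⟩
    have h1 : ∀ N, ∑ k ∈ range N, |v k * starCoeff v j k| ≤ (∑' k, |v k|) * C := fun N => by
      refine (sum_le_sum fun k _ => ?_).trans (?_ : ∑ k ∈ range N, |v k| * C ≤ _)
      · rw [abs_mul]; exact mul_le_mul_of_nonneg_left (hC k) (abs_nonneg _)
      · rw [← sum_mul]
        exact mul_le_mul_of_nonneg_right (hv.abs.sum_le_tsum _ fun _ _ => abs_nonneg _) hC0
    have h2 := h1 (L + 1)
    rw [sum_range_succ] at h2
    have h3 := abs_sum_le_sum_abs (fun k => v k * starCoeff v j k) (range L)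
    rw [starCoeff, sumOp]
    refine (abs_add_le _ _).trans ?_
    rw [abs_mul 2, abs_two]
    linarith [h1 L]

theorem summable_mul_starCoeff {v : ℕ → ℝ} (hv : Summable v) (j : ℕ) :
    Summable fun k => 2 * (v k * starCoeff v j k) := by
  obtain ⟨C, hC⟩ := exists_abs_starCoeff_le hv j
  refine Summable.mul_left 2 (Summable.of_norm_bounded (hv.abs.mul_right C) fun k => ?_)
  rw [Real.norm_eq_abs, abs_mul]
  exact mul_le_mul_of_nonneg_left (hC k) (abs_nonneg _)

/-! ### The generating product and its logarithmic derivative -/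

/-- The coefficient of `x ^ j` in `∏_{k < L} (1 + v_k x) / (1 - v_k x)`, given as a partial sum
of `2 v_k * starCoeff v (j - 1) k` for `j ≥ 1`. -/
noncomputable def starPartial (v : ℕ → ℝ) (L : ℕ) : ℕ → ℝ
  | 0 => 1
  | j + 1 => ∑ k ∈ range L, 2 * (v k * starCoeff v j k)

/-- `sumOp` counts the current term once and earlier ones twice, so it averages consecutive partial
sums of `2u`. This is what produces the factor `(1 + v x)/(1 - v x)`. -/
theorem starPartial_succ_add (v : ℕ → ℝ) (L j : ℕ) :
    starPartial v (L + 1) j + starPartial v L j = 2 * starCoeff v j L := by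
  cases j with
  | zero => norm_num [starPartial, starCoeff]
  | succ j =>
    simp only [starPartial, sum_range_succ, starCoeff, sumOp, mul_sum]
    ring

open PowerSeries in
theorem mk_starPartial_succ (v : ℕ → ℝ) (L : ℕ) :
    PowerSeries.mk (starPartial v (L + 1)) * (1 - C (v L) * X) =
      PowerSeries.mk (starPartial v L) * (1 + C (v L) * X) := by
  ext n
  have e : ∀ a c : ℝ⟦X⟧, a * (c * X) = a * c * X := fun a c => (mul_assoc _ _ _).symm
  rw [mul_sub, mul_add, e, e, mul_one, mul_one, map_sub, map_add]
  cases n with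
  | zero => simp [starPartial]
  | succ n =>
    rw [coeff_succ_mul_X, coeff_succ_mul_X, coeff_mul_C, coeff_mul_C]
    simp only [coeff_mk]
    have h := starPartial_succ_add v L n
    have h2 : starPartial v (L + 1) (n + 1) =
        starPartial v L (n + 1) + 2 * (v L * starCoeff v n L) := by
      simp only [starPartial, sum_range_succ]
    rw [h2]
    linear_combination -v L * h

/-- The power series `2 a / (1 - a² X²)`. -/
noncomputable def evenGeom (a : ℝ) : PowerSeries ℝ :=
  PowerSeries.mk fun n => if Even n then 2 * a ^ (n + 1) else 0

open PowerSeries in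
theorem evenGeom_mul (a : ℝ) :
    evenGeom a * ((1 - C a * X) * (1 + C a * X)) = C (2 * a) := by
  have e : evenGeom a * ((1 - C a * X) * (1 + C a * X)) =
      evenGeom a - evenGeom a * C (a ^ 2) * X ^ 2 := by
    rw [map_pow]; ring
  rw [e]
  ext n
  rw [map_sub, coeff_mul_X_pow', coeff_C]
  rcases n with _ | _ | n
  · simp [evenGeom]
  · simp [evenGeom]
  · rw [if_pos (show 2 ≤ n + 1 + 1 by omega), if_neg (show ¬ n + 1 + 1 = 0 by omega)]
    simp only [evenGeom, coeff_mk, Nat.even_add_one, not_not, Nat.reduceSubDiff,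
      coeff_mul_C]
    split_ifs <;> ring

-- `evenGeom a` is the logarithmic derivative of `(1 + a X)/(1 - a X)`, and these add up over the
-- factors.
open PowerSeries in
theorem derivative_mk_starPartial (v : ℕ → ℝ) (L : ℕ) :
    d⁄dX ℝ (PowerSeries.mk (starPartial v L)) =
      PowerSeries.mk (starPartial v L) * ∑ k ∈ range L, evenGeom (v k) := by
  induction L with
  | zero =>
    have : PowerSeries.mk (starPartial v 0) = 1 := by
      ext n
      rcases n with _ | n <;> simp [starPartial, coeff_one]
    rw [this, derivative_one]
    simp
  | succ L ih =>
    have h := mk_starPartial_succ v L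
    have hd := congrArg (d⁄dX ℝ) h
    have hg := evenGeom_mul (v L)
    rw [sum_range_succ]
    set A := PowerSeries.mk (starPartial v (L + 1))
    set B := PowerSeries.mk (starPartial v L)
    set S := ∑ k ∈ range L, evenGeom (v k)
    set g := evenGeom (v L)
    have h2 : (C (2 * v L) : ℝ⟦X⟧) = 2 * C (v L) := by
      rw [map_mul]; rfl
    rw [h2] at hg
    have h3 : d⁄dX ℝ (1 - C (v L) * X) = -C (v L) := by
      have : (1 - C (v L) * X : ℝ⟦X⟧) = 1 + C (-v L) * X := by rw [map_neg]; ring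
      rw [this, map_add, Derivation.leibniz, derivative_C, derivative_X, derivative_one]
      simp
    rw [Derivation.leibniz, h3] at hd
    simp only [Derivation.leibniz, map_add, derivative_C, derivative_X, derivative_one,
      smul_eq_mul, ih] at hd
    set c := (C (v L) : ℝ⟦X⟧)
    have hne : (1 - c * X) * (1 + c * X) ≠ 0 := by
      intro h0
      have := congrArg constantCoeff h0
      simp at this
    apply mul_right_cancel₀ hne
    linear_combination (1 + c * X) * hd - A * hg - (c + S * (1 + c * X)) * h

theorem succ_mul_starPartial (v : ℕ → ℝ) (L n : ℕ) :
    ((n : ℝ) + 1) * starPartial v L (n + 1) =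
      ∑ b ∈ range (n + 1), (if Even b then ∑ k ∈ range L, 2 * v k ^ (b + 1) else 0) *
        starPartial v L (n - b) := by
  have h := congrArg (PowerSeries.coeff n) (derivative_mk_starPartial v L)
  rw [PowerSeries.coeff_derivative, mul_comm (PowerSeries.mk _), PowerSeries.coeff_mul,
    Nat.sum_antidiagonal_eq_sum_range_succ_mk] at h
  simp only [PowerSeries.coeff_mk, map_sum, evenGeom] at h
  rw [mul_comm, h]
  refine sum_congr rfl fun b _ => ?_
  split_ifs <;> simp

/-! ### Coefficients of the exponential -/

/-- The sum over the tuples of `oddTuples r n` of `∏_j t_j ^ {k_j} / k_j!`. -/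
noncomputable def oddBell (r : ℕ) (t : Fin r → ℝ) (n : ℕ) : ℝ :=
  ∑ k ∈ oddTuples r n, ∏ j : Fin r, 1 / (Nat.factorial (k j) : ℝ) * t j ^ k j

theorem oddBell_zero (r : ℕ) (t : Fin r → ℝ) : oddBell r t 0 = 1 := by
  have : oddTuples r 0 = {0} := by
    ext k
    rw [mem_oddTuples, mem_singleton, sum_eq_zero_iff]
    constructor
    · intro h
      funext j
      have := h j (mem_univ j)
      rcases mul_eq_zero.1 this with h | h
      · omega
      · exact h
    · rintro rfl
      simp
  simp [oddBell, this]

theorem weight_add_single {r : ℕ} (t : Fin r → ℝ) (k : Fin r → ℕ) (j : Fin r) :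
    ((k + (Pi.single j 1 : Fin r → ℕ)) j : ℝ) *
        ∏ i : Fin r, 1 / (Nat.factorial ((k + (Pi.single j 1 : Fin r → ℕ)) i) : ℝ) *
        t i ^ (k + (Pi.single j 1 : Fin r → ℕ)) i =
      t j * ∏ i : Fin r, 1 / (Nat.factorial (k i) : ℝ) * t i ^ k i := by
  rw [← mul_prod_erase univ _ (mem_univ j), ← mul_prod_erase univ (fun i => _ * _) (mem_univ j)]
  have h : ∏ i ∈ univ.erase j, 1 / (Nat.factorial ((k + (Pi.single j 1 : Fin r → ℕ)) i) : ℝ) *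
      t i ^ (k + (Pi.single j 1 : Fin r → ℕ)) i =
        ∏ i ∈ univ.erase j, 1 / (Nat.factorial (k i) : ℝ) * t i ^ k i :=
    prod_congr rfl fun i hi => by simp [Pi.single_eq_of_ne (ne_of_mem_erase hi)]
  rw [h]
  simp only [Pi.add_apply, Pi.single_eq_same, Nat.factorial_succ]
  have : ((k j).factorial : ℝ) ≠ 0 := by positivity
  push_cast
  field_simp
  ring

theorem sum_weight_add_single (r : ℕ) (k : Fin r → ℕ) (j : Fin r) :
    ∑ i : Fin r, (2 * (i : ℕ) + 1) * (k + (Pi.single j 1 : Fin r → ℕ)) i =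
      ∑ i : Fin r, (2 * (i : ℕ) + 1) * k i + (2 * (j : ℕ) + 1) := by
  simp only [Pi.add_apply, mul_add, sum_add_distrib, Pi.single_apply, mul_ite, mul_one, mul_zero,
    sum_ite_eq', mem_univ, if_true]

/-- The factor `k j` kills the tuples with `k j = 0` and cancels against `(k j)!` in the rest, which
are shifts by `Pi.single j 1`. -/
theorem sum_apply_mul_weight (r : ℕ) (t : Fin r → ℝ) (n : ℕ) (j : Fin r) :
    ∑ k ∈ oddTuples r (n + 1), (k j : ℝ) *
        ∏ i : Fin r, 1 / (Nat.factorial (k i) : ℝ) * t i ^ k i =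
      if 2 * (j : ℕ) ≤ n then t j * oddBell r t (n - 2 * j) else 0 := by
  split_ifs with hj
  · rw [oddBell, mul_sum]
    symm
    refine sum_of_injOn (fun k => k + Pi.single j 1) ?_ ?_ ?_ ?_
    · intro a _ b _ h
      exact add_right_cancel h
    · intro k hk
      have hk := mem_oddTuples.1 hk
      refine mem_oddTuples.2 ?_
      rw [sum_weight_add_single, hk]
      omega
    · intro k hk hk'
      rcases Nat.eq_zero_or_pos (k j) with h0 | h0
      · simp [h0]
      · have hle : k - Pi.single j 1 + Pi.single j 1 = k := by
          funext i
          by_cases hi : i = j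
          · subst hi
            simpa using Nat.sub_add_cancel h0
          · simp [Pi.single_eq_of_ne hi]
        refine absurd ⟨k - Pi.single j 1, ?_, ?_⟩ hk'
        · refine mem_oddTuples.2 ?_
          have h1 := sum_weight_add_single r (k - Pi.single j 1) j
          rw [hle, mem_oddTuples.1 hk] at h1
          omega
        · exact hle
    · intro k _
      exact (weight_add_single t k j).symm
  · refine sum_eq_zero fun k hk => ?_
    have h1 := mem_oddTuples.1 hk
    have h2 := single_le_sum (f := fun j : Fin r => (2 * (j : ℕ) + 1) * k j)
      (fun _ _ => Nat.zero_le _) (mem_univ j)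
    simp only [h1] at h2
    have : k j = 0 := by
      by_contra h
      have : 1 ≤ k j := Nat.one_le_iff_ne_zero.2 h
      nlinarith
    simp [this]

/-- The coefficient form of `(exp G)' = G' exp G`: write `n + 1` as the weight of each tuple. -/
theorem succ_mul_oddBell (r : ℕ) (t : Fin r → ℝ) (n : ℕ) :
    ((n : ℝ) + 1) * oddBell r t (n + 1) =
      ∑ j : Fin r, if 2 * (j : ℕ) ≤ n then (2 * (j : ℝ) + 1) * t j * oddBell r t (n - 2 * j)
        else 0 := by
  have h1 : ∀ k ∈ oddTuples r (n + 1), ((n : ℝ) + 1) = ∑ j : Fin r, (2 * (j : ℝ) + 1) * k j := by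
    intro k hk
    have := mem_oddTuples.1 hk
    exact_mod_cast this.symm
  rw [oddBell, mul_sum, sum_congr rfl fun k hk => by rw [h1 k hk, sum_mul], sum_comm]
  refine sum_congr rfl fun j _ => ?_
  simp only [mul_assoc]
  rw [← mul_sum, sum_apply_mul_weight]
  split_ifs <;> ring

/-- Both sides satisfy the same recursion. Since `n ≤ 2r`, the odd power sums that occur have degree
at most `2r - 1`, so `r` variables suffice. -/
theorem starPartial_eq_oddBell (v : ℕ → ℝ) (L r : ℕ) {n : ℕ} (hn : n ≤ 2 * r) :
    starPartial v L n =
      oddBell r (fun j => 2 / (2 * (j : ℝ) + 1) * ∑ k ∈ range L, v k ^ (2 * (j : ℕ) + 1)) n := by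
  induction n using Nat.strong_induction_on with
  | _ n ih =>
    rcases n with _ | n
    · rw [oddBell_zero, starPartial]
    · have h0 : ((n : ℝ) + 1) ≠ 0 := by positivity
      apply mul_left_cancel₀ h0
      rw [succ_mul_starPartial, succ_mul_oddBell, ← sum_filter]
      symm
      refine sum_of_injOn (fun j : Fin r => 2 * (j : ℕ)) ?_ ?_ ?_ ?_
      · intro a _ b _ h
        ext
        simpa using h
      · intro j hj
        have := (mem_filter.1 hj).2
        simp only [coe_range, Set.mem_Iio]
        omega
      · intro b hb hb'
        rw [if_neg, zero_mul]
        rintro ⟨c, rfl⟩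
        have := mem_range.1 hb
        refine hb' ⟨⟨c, by omega⟩, ?_, ?_⟩
        · simp only [coe_filter, mem_univ, true_and, Set.mem_ofPred_eq]
          omega
        · simp only
          omega
      · intro j hj
        rw [if_pos (even_two_mul _), ih (n - 2 * j) (by omega) (by omega), ← mul_sum]
        have : 2 * (j : ℝ) + 1 ≠ 0 := by positivity
        field_simp

theorem tendsto_oddBell {r n : ℕ} {t : ℕ → Fin r → ℝ} {s : Fin r → ℝ}
    (h : ∀ j, Filter.Tendsto (fun L => t L j) Filter.atTop (nhds (s j))) :
    Filter.Tendsto (fun L => oddBell r (t L) n) Filter.atTop (nhds (oddBell r s n)) :=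
  tendsto_finsetSum _ fun _ _ => tendsto_finsetProd _ fun j _ =>
    ((h j).pow _).const_mul _

theorem tsum_starCoeff_eq_oddBell {v : ℕ → ℝ} (hv : Summable v) {r n : ℕ} (hn : n + 1 ≤ 2 * r)
    {s : Fin r → ℝ} (hs : ∀ j : Fin r, HasSum (fun k => 2 / (2 * (j : ℝ) + 1) *
      v k ^ (2 * (j : ℕ) + 1)) (s j)) :
    ∑' k, 2 * (v k * starCoeff v n k) = oddBell r s (n + 1) := by
  have h1 := (summable_mul_starCoeff hv n).hasSum.tendsto_sum_nat
  refine tendsto_nhds_unique h1 ?_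
  have h2 := tendsto_oddBell (n := n + 1) (t := fun L j => 2 / (2 * (j : ℝ) + 1) *
    ∑ k ∈ range L, v k ^ (2 * (j : ℕ) + 1)) (s := s) fun j => by
      simpa only [mul_sum] using (hs j).tendsto_sum_nat
  exact h2.congr fun L => (starPartial_eq_oddBell v L r hn).symm

/-! ### Alternating zeta values and conclusion -/

theorem hasSum_alternating_zeta {N : ℕ} (hN : N ≠ 0) :
    HasSum (fun k : ℕ => (-1) ^ k / ((k : ℝ) + 1) ^ (2 * N))
      ((-1) ^ N * Real.pi ^ (2 * N) * ((2 - 2 ^ (2 * N)) * bernoulli (2 * N) /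
        (2 * (2 * N).factorial))) := by
  have hz := hasSum_zeta_nat hN
  set z := (-1 : ℝ) ^ (N + 1) * (2 : ℝ) ^ (2 * N - 1) * Real.pi ^ (2 * N) *
    bernoulli (2 * N) / (2 * N).factorial with hzdef
  have he : HasSum (fun k : ℕ => 1 / ((2 * k : ℕ) : ℝ) ^ (2 * N)) (1 / 2 ^ (2 * N) * z) := by
    refine (hz.mul_left (1 / (2 : ℝ) ^ (2 * N))).congr_fun ?_
    intro k
    push_cast
    rw [mul_pow, one_div_mul_one_div]
  have ho : Summable (fun k : ℕ => 1 / ((2 * k + 1 : ℕ) : ℝ) ^ (2 * N)) :=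
    hz.summable.comp_injective (i := fun k : ℕ => 2 * k + 1) fun a b h => by simpa using h
  obtain ⟨o, ho⟩ := ho
  have hsum : 1 / 2 ^ (2 * N) * z + o = z :=
    (HasSum.even_add_odd (f := fun n : ℕ => 1 / (n : ℝ) ^ (2 * N)) he ho).unique hz
  have key : HasSum (fun k : ℕ => (-1) ^ k / ((k : ℝ) + 1) ^ (2 * N))
      (o + -(1 / 2 ^ (2 * N) * z)) := by
    -- The dropped index 0 contributes nothing, since `1 / 0 ^ (2 * N) = 0`.
    have he' : HasSum (fun k : ℕ => 1 / ((2 * (k + 1) : ℕ) : ℝ) ^ (2 * N))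
        (1 / 2 ^ (2 * N) * z) := by
      simpa [hN] using (hasSum_nat_add_iff' 1).2 he
    refine HasSum.even_add_odd ?_ ?_
    · convert ho using 2 with k
      simp
    · refine he'.neg.congr_fun fun k => ?_
      push_cast
      rw [pow_succ, pow_mul]
      norm_num
      ring_nf
  convert key using 1
  rw [show o = z - 1 / 2 ^ (2 * N) * z by linear_combination hsum, hzdef]
  obtain ⟨M, rfl⟩ : ∃ M, N = M + 1 := ⟨N - 1, by omega⟩
  rw [show 2 * (M + 1) - 1 = 2 * M + 1 by omega]
  have : ((2 * (M + 1)).factorial : ℝ) ≠ 0 := by positivity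
  field_simp
  ring

theorem summable_altWeight {m : ℕ} (hm : 0 < m) : Summable (altWeight m) :=
  (hasSum_alternating_zeta hm.ne').summable

theorem hasSum_altWeight_pow {m : ℕ} (hm : 0 < m) (j : ℕ) :
    HasSum (fun k => 2 / (2 * (j : ℝ) + 1) * altWeight m k ^ (2 * j + 1))
      (((-1) ^ m * Real.pi ^ (2 * m)) ^ (2 * j + 1) * (bernoulliFactor m (2 * j + 1) : ℝ)) := by
  have h := (hasSum_alternating_zeta (N := m * (2 * j + 1)) (by positivity)).mul_left
    (2 / (2 * (j : ℝ) + 1))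
  have hodd : ∀ k : ℕ, ((-1 : ℝ) ^ k) ^ (2 * j + 1) = (-1) ^ k := fun k => by
    rw [← pow_mul, mul_comm, pow_mul, Odd.neg_one_pow ⟨j, rfl⟩]
  have hval : ((-1) ^ m * Real.pi ^ (2 * m)) ^ (2 * j + 1) *
      (bernoulliFactor m (2 * j + 1) : ℝ) = 2 / (2 * (j : ℝ) + 1) *
        ((-1) ^ (m * (2 * j + 1)) * Real.pi ^ (2 * (m * (2 * j + 1))) *
          ((2 - 2 ^ (2 * (m * (2 * j + 1)))) * bernoulli (2 * (m * (2 * j + 1))) /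
            (2 * (2 * (m * (2 * j + 1))).factorial))) := by
    have h1 : 2 * (j : ℝ) + 1 ≠ 0 := by positivity
    have h2 : ((2 * (m * (2 * j + 1))).factorial : ℝ) ≠ 0 := by positivity
    rw [bernoulliFactor, mul_pow, ← pow_mul, ← pow_mul, mul_assoc 2 m]
    push_cast
    field_simp
  rw [hval]
  refine h.congr_fun fun k => ?_
  rw [altWeight, div_pow, hodd, ← pow_mul, mul_assoc]

/-- Every tuple has weight `n`, so the powers of `π` and the signs factor out. -/
theorem oddBell_pow_mul (r n : ℕ) (c : ℝ) (b : Fin r → ℝ) :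
    oddBell r (fun j => c ^ (2 * (j : ℕ) + 1) * b j) n = c ^ n * oddBell r b n := by
  rw [oddBell, oddBell, mul_sum]
  refine sum_congr rfl fun k hk => ?_
  rw [← mem_oddTuples.1 hk, ← prod_pow_eq_pow_sum, ← prod_mul_distrib]
  refine prod_congr rfl fun j _ => ?_
  rw [mul_pow, ← pow_mul]
  ring

theorem oddBell_bernoulliFactor (m r n : ℕ) :
    oddBell r (fun j => (bernoulliFactor m (2 * (j : ℕ) + 1) : ℝ)) n = (bellSum m r n : ℝ) := by
  rw [oddBell, bellSum]
  push_cast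
  rfl

theorem hasSum_zetaStarTerm_of_kernelRep {m : ℕ} (hm : 0 < m) {s : List ℕ} {r n : ℕ}
    (hn : n + 1 ≤ 2 * r)
    (h : KernelRep s fun k => 2 * (altWeight m k * starCoeff (altWeight m) n k)) :
    HasSum (zetaStarTerm s)
      (((-1) ^ m * Real.pi ^ (2 * m)) ^ (n + 1) * (bellSum m r (n + 1) : ℝ)) := by
  have h1 := h.hasSum (summable_mul_starCoeff (summable_altWeight hm) n)
  rwa [tsum_starCoeff_eq_oddBell (summable_altWeight hm) hn
    fun j : Fin r => hasSum_altWeight_pow hm j, oddBell_pow_mul, oddBell_bernoulliFactor] at h1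

theorem theorem4 (m d : ℕ) (hm : 0 < m) (hd : 0 < d) :
    (Summable (zetaStarTerm (blocks m d)) ∧
      zetaStar (blocks m d) = Real.pi ^ (4 * m * d) * (bellSum m d (2 * d) : ℝ)) ∧
    (Summable (zetaStarTerm (blocks m d ++ List.replicate m 2)) ∧
      zetaStar (blocks m d ++ List.replicate m 2) =
        (-1) ^ m * Real.pi ^ (2 * m * (2 * d + 1)) * (bellSum m (d + 1) (2 * d + 1) : ℝ)) := by
  obtain ⟨e, rfl⟩ : ∃ e, d = e + 1 := ⟨d - 1, by omega⟩
  have h1 := hasSum_zetaStarTerm_of_kernelRep hm (r := e + 1) (by omega) (kernelRep_blocks hm e)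
  have h2 := hasSum_zetaStarTerm_of_kernelRep hm (r := e + 1 + 1) (by omega)
    (kernelRep_blocks_append hm e)
  refine ⟨⟨h1.summable, h1.tsum_eq.trans ?_⟩, h2.summable, h2.tsum_eq.trans ?_⟩
  · rw [mul_pow, ← pow_mul, mul_comm m, pow_mul, Even.neg_one_pow ⟨e + 1, by ring⟩, one_pow,
      one_mul, ← pow_mul]
    congr 2
    ring
  · rw [mul_pow, ← pow_mul (-1), mul_comm m, pow_mul (-1), Odd.neg_one_pow ⟨e + 1, by ring⟩,
      ← pow_mul]
    rfl
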